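/- **Theorem 5.1.** Let $\psi:\mathbb R\to\mathbb R$ be a continuous even function with $0\le\psi\le1$ and $\int_{\mathbb R}\psi(t)\,dt=1$, and let $v\ge0$. For $n\in\mathbb N$ put $N=2n+1$, and let $0<b\le N$. Let $\{a(i,j),\,d(i,j): -n\le i\le j\le n\}$ be jointly independent real random variables on a probability space, where $d(i,j)$ equals $1$ with probability $\psi\big(\tfrac{i-j}{b}\big)$ and $0$ with probability $1-\psi\big(\tfrac{i-j}{b}\big)$. Let $H=H_{n,b}$ be the real symmetric $N\times N$ random matrix with entries $$H(i,j)=b^{-1/2}\,a(i,j)\,d(i,j),\qquad -n\le i\le j\le n,$$ let $\lambda_1,\dots,\lambda_N$ be its eigenvalues (with multiplicity), and let $$g_{n,b}(z)=\int_{\mathbb R}\frac{\sigma_n(d\lambda)}{\lambda-z},\qquad \sigma_n=\frac1N\sum_{k=1}^N\delta_{\lambda_k},$$ be the Stieltjes transform of the normalized eigenvalue counting measure of $H$. Assume that for all $i\le j$ $$\mathbf E\{a(i,j)^{2l+1}\}=0\ (l=0,1,2),\quad \mathbf E\{a(i,j)^2\}=v^2,\quad \mathbf E\{a(i,j)^4\}=3v^4,\quad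 \mathbf E\{a(i,j)^6\}=15v^6,$$ and $\hat\mu_7=\sup_{i\le j}\mathbf E|a(i,j)|^7\le M<\infty$. Then $$\mathbf{Var}\{g_{n,b}(z)\}=\mathbf E\big|g_{n,b}(z)-\mathbf E\,g_{n,b}(z)\big|^2=O\Big(\frac1b\Big)$$ for all large enough $n$ and $b$ and all $z\in\mathbb C$ with $|\operatorname{Im}z|\ge 2v+1$. Precisely, there are constants $C$, $b_0$, $n_0$ depending only on $v$, $\psi$ and $M$ such that, for all $n\ge n_0$, all real $b$ with $b\ge b_0$ and $0<b\le N$, all such random variables and all such $z$, the random variable $g_{n,b}(z)$ is square integrable and $\mathbf{Var}\{g_{n,b}(z)\}\le C/b$. -/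

import Mathlib

open MeasureTheory ProbabilityTheory
open scoped NNReal ENNReal

noncomputable section

/-- The index set `{-n, …, n}` of the rows and columns; it has `N = 2n + 1` elements. -/
abbrev Site (n : ℕ) : Type := ↥(Finset.Icc (-(n : ℤ)) (n : ℤ))

/-- The pairs `(i, j)` with `i ≤ j` and `|i|, |j| ≤ n`. -/
abbrev UpperPair (n : ℕ) : Type := {p : Site n × Site n // p.1 ≤ p.2}

/-- The percolation profiles: continuous even functions `ψ` with `0 ≤ ψ ≤ 1` and integral one.
(The Bochner integral is zero for a function that is not integrable, so `ψ` is integrable.) -/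
structure IsPercolationProfile (ψ : ℝ → ℝ) : Prop where
  continuous : Continuous ψ
  even : Function.Even ψ
  nonneg : ∀ t, 0 ≤ ψ t
  le_one : ∀ t, ψ t ≤ 1
  integral_eq_one : ∫ t, ψ t = 1

/-- The random variables `a(i, j)`, `d(i, j)`, `i ≤ j`, from which the matrix is built: all of them
are jointly independent (that is, the `a(i, j)` are independent, the `d(i, j)` are independent, and
the two families are independent of each other), and `d(i, j)` is a Bernoulli variable that equals
`1` with probability `ψ((i - j)/b)` and `0` with probability `1 - ψ((i - j)/b)`. -/
structure IsPercolationFamily {Ω : Type*} [MeasurableSpace Ω] (P : Measure Ω)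
    (ψ : ℝ → ℝ) (n : ℕ) (b : ℝ) (a d : Site n → Site n → Ω → ℝ) : Prop where
  measurable_a : ∀ i j, i ≤ j → Measurable (a i j)
  measurable_d : ∀ i j, i ≤ j → Measurable (d i j)
  indep : iIndepFun
    (Sum.elim (fun p : UpperPair n => a p.1.1 p.1.2) (fun p : UpperPair n => d p.1.1 p.1.2)) P
  prob_one : ∀ i j, i ≤ j →
    P.real {ω | d i j ω = 1} = ψ ((((i : ℤ) : ℝ) - ((j : ℤ) : ℝ)) / b)
  prob_zero : ∀ i j, i ≤ j →
    P.real {ω | d i j ω = 0} = 1 - ψ ((((i : ℤ) : ℝ) - ((j : ℤ) : ℝ)) / b)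

/-- The supremum over `i ≤ j` of the absolute moments `E |a(i, j)| ^ r`. -/
def supAbsMoment {Ω : Type*} [MeasurableSpace Ω] (P : Measure Ω) {n : ℕ}
    (a : Site n → Site n → Ω → ℝ) (r : ℕ) : ℝ≥0∞ :=
  ⨆ (i : Site n) (j : Site n) (_ : i ≤ j), ∫⁻ ω, ‖a i j ω‖ₑ ^ r ∂P

/-- The real symmetric matrix with `H(i, j) = b ^ (-1/2) a(i, j) d(i, j)` for `i ≤ j`, here for
one realization of the entries `a`, `d`. -/
def percolationMatrix {n : ℕ} (b : ℝ) (a d : Site n → Site n → ℝ) : Matrix (Site n) (Site n) ℝ :=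
  Matrix.of fun i j => (√b)⁻¹ * a (min i j) (max i j) * d (min i j) (max i j)

theorem percolationMatrix_isHermitian {n : ℕ} (b : ℝ) (a d : Site n → Site n → ℝ) :
    (percolationMatrix b a d).IsHermitian := by
  refine Matrix.IsHermitian.ext fun i j => ?_
  simp [percolationMatrix, min_comm, max_comm]

/-- The normalized counting measure `N⁻¹ ∑ δ_{λ_i}` of the eigenvalues (with multiplicity) of a
real symmetric matrix. -/
def eigenvalueMeasure {ι : Type*} [Fintype ι] [DecidableEq ι] {A : Matrix ι ι ℝ}
    (hA : A.IsHermitian) : Measure ℝ :=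
  (Fintype.card ι : ℝ≥0∞)⁻¹ • ∑ i, Measure.dirac (hA.eigenvalues i)

/-- The Stieltjes transform `∫ μ(dx) / (x - z)` of a measure on the real line. -/
def stieltjesTransform (μ : Measure ℝ) (z : ℂ) : ℂ :=
  ∫ x, ((x : ℂ) - z)⁻¹ ∂μ

/-- The random variable `g_{n,b}(z)`: the Stieltjes transform of the normalized eigenvalue counting
measure of the random matrix `H`, as a function of `ω`. -/
def gTransform {Ω : Type*} {n : ℕ} (b : ℝ) (a d : Site n → Site n → Ω → ℝ) (z : ℂ) (ω : Ω) : ℂ :=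
  stieltjesTransform (eigenvalueMeasure
    (percolationMatrix_isHermitian b (fun i j => a i j ω) (fun i j => d i j ω))) z

/-- The variance `E |X - E X|²` of a complex random variable. -/
def complexVariance {Ω : Type*} [MeasurableSpace Ω] (P : Measure Ω) (X : Ω → ℂ) : ℝ :=
  ∫ ω, ‖X ω - ∫ ω', X ω' ∂P‖ ^ 2 ∂P

end

/-! The bound is an Efron–Stein estimate; no expansion of resolvent moments is needed. The products
`a(i,j) d(i,j)` are independent, and `g` is a bounded measurable function of them. The variance of
such a function is at most the sum, over coordinates, of the mean square of the change caused by
resetting that coordinate to `0`.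

Resetting one product alters at most two entries of `H`. By the resolvent identity and cyclicity of
the trace, `Tr G - Tr G'` pairs the change of the matrix with entries of `G' G`. The Ward identity
bounds each column of a resolvent by `1/|Im z|` in `ℓ²`, so these entries are at most `1/|Im z|²`.
Hence one reset moves `g` by at most `2 |a d| / (N √b |Im z|²)`. Since `d ∈ {0, 1}` almost surely,
`E (a d)² ≤ v²`, and summing squares over at most `N²` pairs cancels `N⁻²` and leaves `4 v² / (b |Im
z|⁴)`.

The lemmas that carry this are `integral_pi_norm_sub_integral_sq_le`,
`norm_trace_complexResolvent_sub_le` and `IsPercolationFamily.complexVariance_gTransform_le`. -/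

/-! ### Variance and the Efron–Stein inequality -/

theorem integral_norm_sub_sq_eq {α : Type*} [MeasurableSpace α] {μ : Measure α}
    [IsProbabilityMeasure μ] {f : α → ℂ} (hf : MemLp f 2 μ) (c : ℂ) :
    ∫ x, ‖f x - c‖ ^ 2 ∂μ = ∫ x, ‖f x - ∫ y, f y ∂μ‖ ^ 2 ∂μ + ‖(∫ y, f y ∂μ) - c‖ ^ 2 := by
  set m := ∫ y, f y ∂μ with hm
  have hfi : Integrable f μ := hf.integrable (by norm_num)
  have hg : Integrable (fun x => f x - m) μ := hfi.sub (integrable_const m)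
  have h2 : Integrable (fun x => ‖f x - m‖ ^ 2) μ :=
    (hf.sub (memLp_const m)).integrable_norm_pow (by norm_num)
  have hin : Integrable (fun x => inner ℝ (m - c) (f x - m)) μ := hg.const_inner (m - c)
  have hz : ∫ x, inner ℝ (m - c) (f x - m) ∂μ = 0 := by
    rw [integral_inner hg, integral_sub hfi (integrable_const m)]
    simp [← hm]
  have hpt : ∀ x, ‖f x - c‖ ^ 2 =
      ‖f x - m‖ ^ 2 + (2 * inner ℝ (m - c) (f x - m) + ‖m - c‖ ^ 2) := fun x => by
    have : f x - c = (m - c) + (f x - m) := by ring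
    rw [this, norm_add_sq_real]; ring
  simp_rw [hpt]
  have h3 : Integrable (fun x => 2 * inner ℝ (m - c) (f x - m) + ‖m - c‖ ^ 2) μ :=
    (hin.const_mul 2).add (integrable_const _)
  rw [integral_add h2 h3, integral_add (hin.const_mul 2) (integrable_const _), integral_const_mul, hz]
  simp

theorem integral_norm_sub_integral_sq_le {α : Type*} [MeasurableSpace α] {μ : Measure α}
    [IsProbabilityMeasure μ] {f : α → ℂ} (hf : MemLp f 2 μ) (c : ℂ) :
    ∫ x, ‖f x - ∫ y, f y ∂μ‖ ^ 2 ∂μ ≤ ∫ x, ‖f x - c‖ ^ 2 ∂μ := by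
  rw [integral_norm_sub_sq_eq hf c]
  exact le_add_of_nonneg_right (sq_nonneg _)

theorem MeasureTheory.MemLp.of_measurable_of_norm_le {α : Type*} [MeasurableSpace α]
    {μ : Measure α} [IsFiniteMeasure μ] {f : α → ℂ} (hf : Measurable f) {B : ℝ}
    (hB : ∀ x, ‖f x‖ ≤ B) (p : ℝ≥0∞) : MemLp f p μ :=
  MemLp.of_bound hf.aestronglyMeasurable B (ae_of_all _ hB)

/-- An Efron–Stein inequality for a product of probability measures: the variance of `F` is
controlled by the effect of resetting one coordinate at a time to a fixed value. -/
theorem integral_pi_norm_sub_integral_sq_le {E : Type*} [MeasurableSpace E] (c : E) {B : ℝ} :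
    ∀ {m : ℕ} (μ : Fin m → Measure E) [∀ i, IsProbabilityMeasure (μ i)]
      {F : (Fin m → E) → ℂ}, Measurable F → (∀ x, ‖F x‖ ≤ B) →
      ∀ {w : Fin m → E → ℝ}, (∀ i, Integrable (fun t => w i t ^ 2) (μ i)) →
      (∀ x i, ‖F x - F (Function.update x i c)‖ ≤ w i (x i)) →
      ∫ x, ‖F x - ∫ y, F y ∂Measure.pi μ‖ ^ 2 ∂Measure.pi μ ≤ ∑ i, ∫ t, w i t ^ 2 ∂μ i
  | 0, μ, _, F, hF, hB, w, hw, h => by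
    have hc : ∀ x, F x = F Fin.elim0 := fun x => congrArg F (Subsingleton.elim _ _)
    simp_rw [hc]
    simp
  | m + 1, μ, _, F, hF, hB, w, hw, h => by
    have hmp := (measurePreserving_piFinSuccAbove μ 0).symm
    set e := (MeasurableEquiv.piFinSuccAbove (fun _ : Fin (m + 1) => E) 0).symm with he
    set ν := Measure.pi fun j : Fin m => μ (Fin.succAbove 0 j) with hν
    have hecons : ∀ p : E × (Fin m → E), e p = Fin.cons p.1 p.2 := fun p => by
      rw [he]; ext i; simp [MeasurableEquiv.piFinSuccAbove, Fin.insertNthEquiv]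
    have hΦ : Measurable fun p : E × (Fin m → E) => F (e p) := hF.comp e.measurable
    have hΦL : MemLp (fun p : E × (Fin m → E) => F (e p)) 2 ((μ 0).prod ν) :=
      .of_measurable_of_norm_le hΦ (fun _ => hB _) 2
    have hsec : ∀ x, MemLp (fun y => F (e (y, x))) 2 (μ 0) := fun x =>
      .of_measurable_of_norm_le (hΦ.comp measurable_prodMk_right) (fun _ => hB _) 2
    set G : (Fin m → E) → ℂ := fun x => ∫ y, F (e (y, x)) ∂μ 0 with hG
    have hGm : Measurable G :=
      (hΦ.stronglyMeasurable.integral_prod_left').measurable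
    have hGB : ∀ x, ‖G x‖ ≤ B := fun x => by
      simpa using norm_integral_le_of_norm_le_const (μ := μ 0) (ae_of_all _ fun y => hB (e (y, x)))
    have hGL : MemLp G 2 ν := .of_measurable_of_norm_le hGm hGB 2
    -- Averaging over coordinate `0` preserves the increment bounds in the other coordinates, so the
    -- induction hypothesis applies to `G`.
    have hIH := integral_pi_norm_sub_integral_sq_le c (fun j : Fin m => μ (Fin.succAbove 0 j))
      hGm hGB (w := fun j => w (Fin.succAbove 0 j)) (fun j => hw _) (fun x i => by
        have hd : G x - G (Function.update x i c) =
            ∫ y, (F (e (y, x)) - F (e (y, Function.update x i c))) ∂μ 0 :=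
          (integral_sub ((hsec _).integrable (by norm_num))
            ((hsec _).integrable (by norm_num))).symm
        rw [hd]
        have := norm_integral_le_of_norm_le_const (μ := μ 0) (C := w i.succ (x i))
          (f := fun y => F (e (y, x)) - F (e (y, Function.update x i c)))
          (ae_of_all _ fun y => by
            have := h (Fin.cons y x) i.succ
            rw [← Fin.cons_update] at this
            simpa [hecons] using this)
        simpa using this)
    have hmean : ∫ y, F y ∂Measure.pi μ = ∫ x, G x ∂ν := by
      rw [← hmp.integral_comp' (g := F), integral_prod_symm _ (hΦL.integrable (by norm_num))]
    set A := ∫ y, F y ∂Measure.pi μ with hA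
    have hint : Integrable (fun p : E × (Fin m → E) => ‖F (e p) - A‖ ^ 2) ((μ 0).prod ν) :=
      (hΦL.sub (memLp_const A)).integrable_norm_pow (by norm_num)
    have hG2 : Integrable (fun x => ‖G x - A‖ ^ 2) ν :=
      (hGL.sub (memLp_const A)).integrable_norm_pow (by norm_num)
    have hsecle : ∀ x, ∫ y, ‖F (e (y, x)) - A‖ ^ 2 ∂μ 0 ≤
        ∫ t, w 0 t ^ 2 ∂μ 0 + ‖G x - A‖ ^ 2 := fun x => by
      -- Law of total variance: the variance within the section, plus the squared deviation of its
      -- mean `G x` from `A`.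
      rw [integral_norm_sub_sq_eq (hsec x) A]
      refine add_le_add_left ?_ _
      -- The mean minimises the mean-square distance, so it may be replaced by the value at `c`; a
      -- fixed reset value thus serves in place of an independent copy.
      refine (integral_norm_sub_integral_sq_le (hsec x) (F (e (c, x)))).trans ?_
      refine integral_mono_of_nonneg (ae_of_all _ fun y => sq_nonneg _) (hw 0)
        (ae_of_all _ fun y => ?_)
      have := h (Fin.cons y x) 0
      rw [Fin.update_cons_zero] at this
      simp only [hecons]
      exact pow_le_pow_left₀ (norm_nonneg _) (by simpa using this) 2
    calc ∫ x, ‖F x - A‖ ^ 2 ∂Measure.pi μ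
        = ∫ x, ∫ y, ‖F (e (y, x)) - A‖ ^ 2 ∂μ 0 ∂ν := by
          rw [← hmp.integral_comp' (g := fun x => ‖F x - A‖ ^ 2), integral_prod_symm _ hint]
      _ ≤ ∫ x, (∫ t, w 0 t ^ 2 ∂μ 0 + ‖G x - A‖ ^ 2) ∂ν :=
          integral_mono hint.integral_prod_right ((integrable_const _).add hG2) hsecle
      _ = ∫ t, w 0 t ^ 2 ∂μ 0 + ∫ x, ‖G x - ∫ x, G x ∂ν‖ ^ 2 ∂ν := by
          rw [integral_add (integrable_const _) hG2, ← hmean]; simp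
      _ ≤ ∑ i, ∫ t, w i t ^ 2 ∂μ i := by
          rw [Fin.sum_univ_succ]
          exact add_le_add_right hIH _

/-- An Efron–Stein inequality for functions of finitely many independent random variables. -/
theorem ProbabilityTheory.iIndepFun.integral_norm_sub_integral_sq_le {Ω E ι : Type*}
    [MeasurableSpace Ω] [MeasurableSpace E] [Fintype ι] [DecidableEq ι] {P : Measure Ω}
    [IsProbabilityMeasure P] {Z : ι → Ω → E} (hZ : iIndepFun Z P) (hZm : ∀ i, Measurable (Z i))
    (c : E) {B : ℝ} {F : (ι → E) → ℂ} (hF : Measurable F) (hB : ∀ x, ‖F x‖ ≤ B)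
    {w : ι → E → ℝ} (hwm : ∀ i, Measurable (w i))
    (hw : ∀ i, Integrable (fun ω => w i (Z i ω) ^ 2) P)
    (h : ∀ x i, ‖F x - F (Function.update x i c)‖ ≤ w i (x i)) :
    ∫ ω, ‖F (fun i => Z i ω) - ∫ ω', F (fun i => Z i ω') ∂P‖ ^ 2 ∂P ≤
      ∑ i, ∫ ω, w i (Z i ω) ^ 2 ∂P := by
  let e := Fintype.equivFin ι
  have hind : iIndepFun (fun k => Z (e.symm k)) P := hZ.precomp e.symm.injective
  have hmap := (iIndepFun_iff_map_fun_eq_pi_map fun k => (hZm (e.symm k)).aemeasurable).1 hind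
  have hprob : ∀ k, IsProbabilityMeasure (P.map (Z (e.symm k))) := fun k =>
    Measure.isProbabilityMeasure_map (hZm _).aemeasurable
  have hZt : AEMeasurable (fun ω k => Z (e.symm k) ω) P :=
    (measurable_pi_lambda _ fun k => hZm _).aemeasurable
  have hsq : ∀ i, Measurable fun t => w i t ^ 2 := fun i => (hwm i).pow_const 2
  have hF' : Measurable fun x : Fin (Fintype.card ι) → E => F (fun i => x (e i)) :=
    hF.comp (measurable_pi_lambda _ fun i => measurable_pi_apply _)
  have key := integral_pi_norm_sub_integral_sq_le c (fun k => P.map (Z (e.symm k))) hF'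
    (fun x => hB _) (w := fun k => w (e.symm k))
    (fun k => (integrable_map_measure (hsq _).aestronglyMeasurable (hZm _).aemeasurable).2 (hw _))
    (fun x k => by
      have hu : (fun i => Function.update x k c (e i)) =
          Function.update (fun i => x (e i)) (e.symm k) c := by
        ext i
        by_cases hi : e i = k
        · subst hi; simp
        · have : i ≠ e.symm k := fun hh => hi (by simp [hh])
          simp [hi, this]
      rw [hu]
      simpa using h (fun i => x (e i)) (e.symm k))
  rw [← hmap, integral_map hZt hF'.aestronglyMeasurable,
    integral_map hZt ((hF'.sub_const _).norm.pow_const 2).aestronglyMeasurable] at key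
  simp only [Equiv.symm_apply_apply] at key
  refine key.trans_eq ?_
  rw [← Equiv.sum_comp e.symm]
  exact Finset.sum_congr rfl fun k _ =>
    integral_map (hZm _).aemeasurable (hsq _).aestronglyMeasurable

/-! ### Resolvents of real symmetric matrices -/

/-- The resolvent `(A - z)⁻¹` of a real matrix at a complex point. -/
noncomputable def complexResolvent {ι : Type*} [Fintype ι] [DecidableEq ι] (A : Matrix ι ι ℝ)
    (z : ℂ) : Matrix ι ι ℂ :=
  (A.map Complex.ofReal - z • (1 : Matrix ι ι ℂ))⁻¹

section Resolvent

variable {ι : Type*} [Fintype ι] [DecidableEq ι] {A A' : Matrix ι ι ℝ} {z : ℂ}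

theorem exists_diagonalization_complex (hA : A.IsHermitian) :
    ∃ U V : Matrix ι ι ℂ, U * V = 1 ∧ V * U = 1 ∧ ∀ z : ℂ,
      A.map Complex.ofReal - z • (1 : Matrix ι ι ℂ) =
        U * Matrix.diagonal (fun i => (hA.eigenvalues i : ℂ) - z) * V := by
  set W := hA.eigenvectorUnitary with hW
  have h1 : (W : Matrix ι ι ℝ) * star (W : Matrix ι ι ℝ) = 1 := Unitary.mul_star_self_of_mem W.2
  have h2 : star (W : Matrix ι ι ℝ) * (W : Matrix ι ι ℝ) = 1 := Unitary.star_mul_self_of_mem W.2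
  have hspec : A = (W : Matrix ι ι ℝ) * Matrix.diagonal hA.eigenvalues *
      star (W : Matrix ι ι ℝ) := by
    simpa [Unitary.conjStarAlgAut_apply, Function.comp_def] using hA.spectral_theorem
  let φ : Matrix ι ι ℝ →+* Matrix ι ι ℂ := Complex.ofRealHom.mapMatrix
  have hUV : φ W * φ (star (W : Matrix ι ι ℝ)) = 1 := by rw [← map_mul, h1, map_one]
  refine ⟨φ W, φ (star (W : Matrix ι ι ℝ)), hUV, by rw [← map_mul, h2, map_one], fun z => ?_⟩
  have hd : Matrix.diagonal (fun i => (hA.eigenvalues i : ℂ) - z) =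
      φ (Matrix.diagonal hA.eigenvalues) - z • (1 : Matrix ι ι ℂ) := by
    ext i j
    by_cases hij : i = j
    · subst hij; simp [φ]
    · simp [φ, hij]
  have hmap : A.map Complex.ofReal = φ A := rfl
  rw [hd, mul_sub, sub_mul, ← map_mul, ← map_mul, ← hspec, hmap]
  simp [hUV]

theorem ofReal_sub_ne_zero (hz : z.im ≠ 0) (x : ℝ) : (x : ℂ) - z ≠ 0 := fun h => hz <| by
  simpa using congrArg Complex.im h

theorem complexResolvent_eq_of_diagonalization {f : ι → ℂ} {U V : Matrix ι ι ℂ}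
    (hUV : U * V = 1) (hVU : V * U = 1) (hf : ∀ i, f i ≠ 0)
    (h : A.map Complex.ofReal - z • (1 : Matrix ι ι ℂ) = U * Matrix.diagonal f * V) :
    (A.map Complex.ofReal - z • (1 : Matrix ι ι ℂ)) * (U * Matrix.diagonal (fun i => (f i)⁻¹) * V) =
      1 := by
  have hd : Matrix.diagonal f * Matrix.diagonal (fun i => (f i)⁻¹) = 1 := by
    rw [Matrix.diagonal_mul_diagonal, ← Matrix.diagonal_one]
    exact congrArg _ (funext fun i => mul_inv_cancel₀ (hf i))
  calc _ = U * (Matrix.diagonal f * (V * U) * Matrix.diagonal (fun i => (f i)⁻¹)) * V := by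
        rw [h]; simp only [Matrix.mul_assoc]
    _ = 1 := by rw [hVU, Matrix.mul_one, hd, Matrix.mul_one, hUV]

theorem mul_complexResolvent (hA : A.IsHermitian) (hz : z.im ≠ 0) :
    (A.map Complex.ofReal - z • (1 : Matrix ι ι ℂ)) * complexResolvent A z = 1 := by
  obtain ⟨U, V, hUV, hVU, h⟩ := exists_diagonalization_complex hA
  have := complexResolvent_eq_of_diagonalization hUV hVU
    (fun i => ofReal_sub_ne_zero hz (hA.eigenvalues i)) (h z)
  rw [complexResolvent, Matrix.inv_eq_right_inv this, this]

theorem complexResolvent_mul (hA : A.IsHermitian) (hz : z.im ≠ 0) :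
    complexResolvent A z * (A.map Complex.ofReal - z • (1 : Matrix ι ι ℂ)) = 1 :=
  mul_eq_one_comm.1 (mul_complexResolvent hA hz)

theorem trace_complexResolvent (hA : A.IsHermitian) (hz : z.im ≠ 0) :
    (complexResolvent A z).trace = ∑ i, ((hA.eigenvalues i : ℂ) - z)⁻¹ := by
  obtain ⟨U, V, hUV, hVU, h⟩ := exists_diagonalization_complex hA
  have := complexResolvent_eq_of_diagonalization hUV hVU
    (fun i => ofReal_sub_ne_zero hz (hA.eigenvalues i)) (h z)
  rw [complexResolvent, Matrix.inv_eq_right_inv this, Matrix.trace_mul_cycle, hVU, Matrix.one_mul,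
    Matrix.trace_diagonal]

theorem stieltjesTransform_eigenvalueMeasure (hA : A.IsHermitian) (hz : z.im ≠ 0) :
    stieltjesTransform (eigenvalueMeasure hA) z =
      (Fintype.card ι : ℂ)⁻¹ * (complexResolvent A z).trace := by
  rw [stieltjesTransform, eigenvalueMeasure, integral_smul_measure,
    integral_finsetSum_measure fun i _ => integrable_dirac (by simp [enorm_lt_top]),
    trace_complexResolvent hA hz]
  simp [Complex.real_smul]

theorem complexResolvent_transpose (hA : A.IsHermitian) :
    (complexResolvent A z).transpose = complexResolvent A z := by
  have hAt : A.transpose = A := by simpa [Matrix.IsHermitian] using hA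
  rw [complexResolvent, Matrix.transpose_nonsing_inv, Matrix.transpose_sub, Matrix.transpose_smul,
    Matrix.transpose_one, ← Matrix.transpose_map, hAt]

/-- The Ward identity `G* G = (G - G*) / (2i Im z)` on the diagonal. -/
theorem im_mul_sum_norm_sq_complexResolvent (hA : A.IsHermitian) (hz : z.im ≠ 0) (j : ι) :
    z.im * ∑ k, ‖complexResolvent A z k j‖ ^ 2 = (complexResolvent A z j j).im := by
  set G := complexResolvent A z with hG
  set B := A.map Complex.ofReal - z • (1 : Matrix ι ι ℂ) with hB
  have hBG : B * G = 1 := mul_complexResolvent hA hz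
  -- As `A` is real symmetric, taking the adjoint only replaces `z` by its conjugate.
  have hBH : B.conjTranspose = B + (2 * z.im * Complex.I) • (1 : Matrix ι ι ℂ) := by
    ext i k
    have hs : A k i = A i k := by simpa using hA.apply i k
    have hzc : (starRingEnd ℂ) z = z - 2 * z.im * Complex.I := by
      apply Complex.ext <;> simp; ring
    by_cases hik : i = k
    · subst hik; simp [hB, hzc]; ring
    · simp [hB, hik, Ne.symm hik, hs]
  have hGH : G.conjTranspose * B.conjTranspose = 1 := by
    rw [← Matrix.conjTranspose_mul, hBG, Matrix.conjTranspose_one]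
  have hid : G = G.conjTranspose + (2 * z.im * Complex.I) • (G.conjTranspose * G) := by
    have : G.conjTranspose * B.conjTranspose * G = G := by rw [hGH, Matrix.one_mul]
    rw [hBH, Matrix.mul_add, Matrix.add_mul, Matrix.mul_assoc, hBG, Matrix.mul_one] at this
    simpa using this.symm
  have hjj := congrArg (fun T : Matrix ι ι ℂ => (T j j).im) hid
  have hsum : (G.conjTranspose * G) j j = ((∑ k, ‖G k j‖ ^ 2 : ℝ) : ℂ) := by
    simp [Matrix.mul_apply, Matrix.conjTranspose_apply, Complex.conj_mul']
  simp only [Matrix.add_apply, Matrix.smul_apply, hsum, Matrix.conjTranspose_apply,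
    Complex.add_im, smul_eq_mul, Complex.im_mul_ofReal, RCLike.star_def, Complex.conj_im] at hjj
  have : (2 * (z.im : ℂ) * Complex.I).im = 2 * z.im := by simp
  rw [this] at hjj
  linarith

/-- With `S` the column sum, the Ward identity gives `(Im z · S)² = (Im G_jj)² ≤ |G_jj|² ≤ S`;
divide by `S` when it is positive. -/
theorem im_sq_mul_sum_norm_sq_complexResolvent_le (hA : A.IsHermitian) (hz : z.im ≠ 0)
    (j : ι) : z.im ^ 2 * ∑ k, ‖complexResolvent A z k j‖ ^ 2 ≤ 1 := by
  have hW := im_mul_sum_norm_sq_complexResolvent hA hz j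
  set S := ∑ k, ‖complexResolvent A z k j‖ ^ 2 with hS
  have hS0 : 0 ≤ S := Finset.sum_nonneg fun _ _ => sq_nonneg _
  have h1 : (complexResolvent A z j j).im ^ 2 ≤ S := by
    calc (complexResolvent A z j j).im ^ 2 ≤ ‖complexResolvent A z j j‖ ^ 2 :=
          sq_le_sq.2 (by simpa using Complex.abs_im_le_norm (complexResolvent A z j j))
      _ ≤ S := Finset.single_le_sum (f := fun k => ‖complexResolvent A z k j‖ ^ 2)
          (fun _ _ => sq_nonneg _) (Finset.mem_univ j)
  rw [← hW] at h1
  by_contra! hc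
  have hpos : 0 < S := by
    rcases hS0.eq_or_lt with h | h
    · rw [← h] at hc; norm_num at hc
    · exact h
  nlinarith [mul_lt_mul_of_pos_right hc hpos]

/-- Rows of `G'` are columns by symmetry, so Cauchy–Schwarz and the column bound suffice, without
operator norms. -/
theorem norm_complexResolvent_mul_apply_le (hA : A.IsHermitian) (hA' : A'.IsHermitian)
    (hz : z.im ≠ 0) (i j : ι) :
    ‖(complexResolvent A' z * complexResolvent A z) i j‖ ≤ (z.im ^ 2)⁻¹ := by
  have hpos : 0 < z.im ^ 2 := by positivity
  have hcol : ∀ k, complexResolvent A' z i k = complexResolvent A' z k i := fun k =>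
    (congrFun (congrFun (complexResolvent_transpose hA' (z := z)) i) k).symm
  have h1 := im_sq_mul_sum_norm_sq_complexResolvent_le hA hz j
  have h2 := im_sq_mul_sum_norm_sq_complexResolvent_le hA' hz i
  rw [← le_inv_mul_iff₀ hpos, mul_one] at h1 h2
  rw [Matrix.mul_apply]
  calc ‖∑ k, complexResolvent A' z i k * complexResolvent A z k j‖
      ≤ ∑ k, ‖complexResolvent A' z k i‖ * ‖complexResolvent A z k j‖ :=
        (norm_sum_le _ _).trans_eq (Finset.sum_congr rfl fun k _ => by rw [norm_mul, hcol])
    _ ≤ √(∑ k, ‖complexResolvent A' z k i‖ ^ 2) * √(∑ k, ‖complexResolvent A z k j‖ ^ 2) :=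
        Real.sum_mul_le_sqrt_mul_sqrt _ _ _
    _ ≤ √((z.im ^ 2)⁻¹) * √((z.im ^ 2)⁻¹) := by gcongr
    _ = (z.im ^ 2)⁻¹ := Real.mul_self_sqrt (by positivity)

/-- From `G - G' = G (A' - A) G'`, cyclicity turns the trace into a pairing of `A' - A` with `G' G`,
whose entries are uniformly bounded. -/
theorem norm_trace_complexResolvent_sub_le (hA : A.IsHermitian) (hA' : A'.IsHermitian)
    (hz : z.im ≠ 0) :
    ‖(complexResolvent A z).trace - (complexResolvent A' z).trace‖ ≤
      (z.im ^ 2)⁻¹ * ∑ i, ∑ j, |A i j - A' i j| := by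
  have hid : complexResolvent A z - complexResolvent A' z =
      complexResolvent A z * (A' - A).map Complex.ofReal * complexResolvent A' z := by
    have hsub : (A' - A).map Complex.ofReal =
        (A'.map Complex.ofReal - z • (1 : Matrix ι ι ℂ)) -
          (A.map Complex.ofReal - z • (1 : Matrix ι ι ℂ)) := by
      rw [sub_sub_sub_cancel_right]
      ext; simp
    rw [hsub, Matrix.mul_sub, Matrix.sub_mul, Matrix.mul_assoc, mul_complexResolvent hA' hz,
      complexResolvent_mul hA hz, Matrix.mul_one, Matrix.one_mul]
  rw [← Matrix.trace_sub, hid, Matrix.trace_mul_cycle, Matrix.trace_mul_comm, Finset.mul_sum]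
  refine (norm_sum_le _ _).trans (Finset.sum_le_sum fun i _ => ?_)
  rw [Matrix.diag_apply, Matrix.mul_apply, Finset.mul_sum]
  refine (norm_sum_le _ _).trans (Finset.sum_le_sum fun j _ => ?_)
  rw [norm_mul, mul_comm]
  refine mul_le_mul (norm_complexResolvent_mul_apply_le hA hA' hz j i) (le_of_eq ?_)
    (norm_nonneg _) (by positivity)
  rw [Matrix.map_apply, Complex.norm_real, Real.norm_eq_abs, Matrix.sub_apply, abs_sub_comm]

theorem norm_trace_complexResolvent_le (hA : A.IsHermitian) (hz : z.im ≠ 0) :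
    ‖(complexResolvent A z).trace‖ ≤ Fintype.card ι * |z.im|⁻¹ := by
  rw [trace_complexResolvent hA hz]
  refine (norm_sum_le _ _).trans ?_
  refine (Finset.sum_le_card_nsmul _ _ |z.im|⁻¹ fun i _ => ?_).trans_eq (by simp)
  rw [norm_inv]
  refine inv_anti₀ (abs_pos.2 hz) ?_
  simpa using Complex.abs_im_le_norm ((hA.eigenvalues i : ℂ) - z)

/-- By Cramer's rule the trace is a quotient of polynomials in the entries. -/
theorem measurable_trace_complexResolvent {α : Type*} [MeasurableSpace α] {T : α → Matrix ι ι ℝ}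
    (hT : ∀ i j, Measurable fun x => T x i j) (z : ℂ) :
    Measurable fun x => (complexResolvent (T x) z).trace := by
  have hB : ∀ i j, Measurable fun x =>
      ((T x).map Complex.ofReal - z • (1 : Matrix ι ι ℂ)) i j := fun i j =>
    (Complex.measurable_ofReal.comp (hT i j)).sub_const _
  have hdet : ∀ S : α → Matrix ι ι ℂ, (∀ i j, Measurable fun x => S x i j) →
      Measurable fun x => (S x).det := fun S hS => by
    simp_rw [Matrix.det_apply']
    exact Finset.measurable_fun_sum _ fun σ _ =>
      (Finset.measurable_fun_prod _ fun i _ => hS _ _).const_mul _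
  have hadj : ∀ i, Measurable fun x =>
      ((T x).map Complex.ofReal - z • (1 : Matrix ι ι ℂ)).adjugate i i := fun i => by
    simp_rw [Matrix.adjugate_apply]
    refine hdet _ fun k l => ?_
    by_cases hk : k = i
    · subst hk; simp
    · simpa [Matrix.updateRow_apply, hk] using hB k l
  simp only [complexResolvent, Matrix.inv_def, Matrix.trace, Matrix.diag_apply, Matrix.smul_apply,
    Ring.inverse_eq_inv', smul_eq_mul]
  exact Finset.measurable_fun_sum _ fun i _ => (hdet _ hB).inv.mul (hadj i)

end Resolvent

/-! ### Grouping independent variables into pairs -/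

/-- Measurable rectangles form a π-system generating the product σ-algebra, and on them the joint
independence factorises completely. -/
theorem ProbabilityTheory.iIndepFun.prodMk_of_sumElim {Ω ι β : Type*} [MeasurableSpace Ω]
    [MeasurableSpace β] {P : Measure Ω} {X : ι → Ω → β}
    {Y : ι → Ω → β} (hX : ∀ i, Measurable (X i)) (hY : ∀ i, Measurable (Y i))
    (h : iIndepFun (Sum.elim X Y) P) : iIndepFun (fun i ω => (X i ω, Y i ω)) P := by
  classical
  rw [iIndepFun_iff_iIndep]
  refine iIndepSets.iIndep (fun i => ((hX i).prodMk (hY i)).comap_le)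
    (fun i => Set.preimage (fun ω => (X i ω, Y i ω)) ''
      Set.image2 (· ×ˢ ·) {s : Set β | MeasurableSet s} {t : Set β | MeasurableSet t})
    (fun i => isPiSystem_prod.comap _) (fun i => ?_) ?_
  · rw [← generateFrom_prod, MeasurableSpace.comap_generateFrom]
  · rw [iIndepSets_iff]
    intro s f hf
    have hf' : ∀ i, ∃ S T : Set β, MeasurableSet S ∧ MeasurableSet T ∧
        (i ∈ s → f i = X i ⁻¹' S ∩ Y i ⁻¹' T) := fun i => by
      by_cases hi : i ∈ s
      · obtain ⟨_, ⟨S, hS, T, hT, rfl⟩, hST⟩ := hf i hi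
        exact ⟨S, T, hS, hT, fun _ => hST.symm⟩
      · exact ⟨∅, ∅, .empty, .empty, fun h => absurd h hi⟩
    choose S T hS hT hST using hf'
    have hprod : ∀ t : Finset ι, P (⋂ i ∈ t, (X i ⁻¹' S i ∩ Y i ⁻¹' T i)) =
        ∏ i ∈ t, P (X i ⁻¹' S i) * P (Y i ⁻¹' T i) := fun t => by
      have := h.measure_inter_preimage_eq_mul (t.disjSum t) (sets := Sum.elim S T) (by
        rintro (i | i) _
        · exact hS i
        · exact hT i)
      rw [Finset.prod_disjSum, ← Finset.prod_mul_distrib] at this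
      simp only [Sum.elim_inl, Sum.elim_inr] at this
      rw [← this]
      congr 1
      ext ω
      simp only [Set.mem_iInter, Set.mem_inter_iff, Set.mem_preimage, Finset.mem_disjSum]
      constructor
      · rintro hω _ (⟨i, hi, rfl⟩ | ⟨i, hi, rfl⟩)
        · exact (hω i hi).1
        · exact (hω i hi).2
      · exact fun hω i hi => ⟨hω (.inl i) (.inl ⟨i, hi, rfl⟩), hω (.inr i) (.inr ⟨i, hi, rfl⟩)⟩
    rw [Set.iInter₂_congr hST, hprod]
    refine Finset.prod_congr rfl fun i hi => ?_
    rw [hST i hi]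
    simpa using (hprod {i}).symm

/-! ### The normalized trace as a function of the independent entries -/

/-- The symmetric matrix with entries `b ^ (-1/2) x (i, j)` for `i ≤ j`. -/
noncomputable def symmetricMatrix {n : ℕ} (b : ℝ) (x : UpperPair n → ℝ) :
    Matrix (Site n) (Site n) ℝ :=
  Matrix.of fun i j => (√b)⁻¹ * x ⟨(min i j, max i j), min_le_max⟩

theorem symmetricMatrix_isHermitian {n : ℕ} (b : ℝ) (x : UpperPair n → ℝ) :
    (symmetricMatrix b x).IsHermitian := by
  refine Matrix.IsHermitian.ext fun i j => ?_
  simp [symmetricMatrix, min_comm, max_comm]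

theorem percolationMatrix_eq_symmetricMatrix {n : ℕ} (b : ℝ) (a d : Site n → Site n → ℝ) :
    percolationMatrix b a d =
      symmetricMatrix b fun p : UpperPair n => a p.1.1 p.1.2 * d p.1.1 p.1.2 := by
  ext i j
  simp [percolationMatrix, symmetricMatrix, mul_assoc]

theorem sum_abs_symmetricMatrix_sub_update_le {n : ℕ} (b : ℝ) (x : UpperPair n → ℝ)
    (p : UpperPair n) :
    ∑ i, ∑ j, |symmetricMatrix b x i j - symmetricMatrix b (Function.update x p 0) i j| ≤
      2 * ((√b)⁻¹ * |x p|) := by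
  have hb : 0 ≤ (√b)⁻¹ * |x p| := by positivity
  -- The positions `(i, j)` and `(j, i)` give the factor `2`; for a diagonal pair they coincide and
  -- the bound counts it twice.
  have hle : ∀ i j, |symmetricMatrix b x i j - symmetricMatrix b (Function.update x p 0) i j| ≤
      (if i = p.1.1 then if j = p.1.2 then (√b)⁻¹ * |x p| else 0 else 0) +
      (if i = p.1.2 then if j = p.1.1 then (√b)⁻¹ * |x p| else 0 else 0) := fun i j => by
    by_cases hq : (⟨(min i j, max i j), min_le_max⟩ : UpperPair n) = p
    · have h0 : |symmetricMatrix b x i j - symmetricMatrix b (Function.update x p 0) i j| =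
          (√b)⁻¹ * |x p| := by
        simp only [symmetricMatrix, Matrix.of_apply, hq, Function.update_self, mul_zero, sub_zero]
        rw [abs_mul, abs_of_nonneg (by positivity : 0 ≤ (√b)⁻¹)]
      rw [h0]
      rcases le_total i j with hij | hij
      · have h1 : i = p.1.1 := by rw [← hq]; exact (min_eq_left hij).symm
        have h2 : j = p.1.2 := by rw [← hq]; exact (max_eq_right hij).symm
        rw [if_pos h1, if_pos h2]
        refine le_add_of_nonneg_right ?_
        split_ifs <;> first | exact hb | exact le_rfl
      · have h1 : j = p.1.1 := by rw [← hq]; exact (min_eq_right hij).symm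
        have h2 : i = p.1.2 := by rw [← hq]; exact (max_eq_left hij).symm
        rw [if_pos h2, if_pos h1]
        refine le_add_of_nonneg_left ?_
        split_ifs <;> first | exact hb | exact le_rfl
    · have h0 : symmetricMatrix b x i j - symmetricMatrix b (Function.update x p 0) i j = 0 := by
        simp [symmetricMatrix, Function.update_of_ne hq]
      rw [h0, abs_zero]
      refine add_nonneg ?_ ?_ <;> split_ifs <;> first | exact hb | exact le_rfl
  refine (Finset.sum_le_sum fun i _ => Finset.sum_le_sum fun j _ => hle i j).trans_eq ?_
  simp [Finset.sum_add_distrib, two_mul]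

theorem card_site (n : ℕ) : Fintype.card (Site n) = 2 * n + 1 := by
  rw [Fintype.card_coe, Int.card_Icc]
  omega

/-- The normalized trace `N⁻¹ Tr (H - z)⁻¹` as a function of the entries of the matrix. -/
noncomputable def normalizedTraceResolvent {n : ℕ} (b : ℝ) (z : ℂ) (x : UpperPair n → ℝ) : ℂ :=
  (Fintype.card (Site n) : ℂ)⁻¹ * (complexResolvent (symmetricMatrix b x) z).trace

section NormalizedTrace

variable {n : ℕ} {b : ℝ} {z : ℂ}

theorem gTransform_eq {Ω : Type*} (a d : Site n → Site n → Ω → ℝ) (hz : z.im ≠ 0) (ω : Ω) :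
    gTransform b a d z ω = normalizedTraceResolvent b z
      fun p : UpperPair n => a p.1.1 p.1.2 ω * d p.1.1 p.1.2 ω := by
  rw [gTransform, stieltjesTransform_eigenvalueMeasure _ hz, normalizedTraceResolvent,
    percolationMatrix_eq_symmetricMatrix]

theorem measurable_normalizedTraceResolvent :
    Measurable (normalizedTraceResolvent b z : (UpperPair n → ℝ) → ℂ) :=
  (measurable_trace_complexResolvent
    (fun _ _ => (measurable_pi_apply _).const_mul _) z).const_mul _

theorem card_site_pos (n : ℕ) : (0 : ℝ) < Fintype.card (Site n) := by
  rw [card_site]; positivity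

theorem norm_normalizedTraceResolvent_le (hz : z.im ≠ 0) (x : UpperPair n → ℝ) :
    ‖normalizedTraceResolvent b z x‖ ≤ |z.im|⁻¹ := by
  have := norm_trace_complexResolvent_le (symmetricMatrix_isHermitian b x) hz
  rw [normalizedTraceResolvent, norm_mul, norm_inv, Complex.norm_natCast]
  rwa [inv_mul_le_iff₀ (card_site_pos n)]

theorem norm_normalizedTraceResolvent_sub_update_le (hz : z.im ≠ 0) (x : UpperPair n → ℝ)
    (p : UpperPair n) :
    ‖normalizedTraceResolvent b z x - normalizedTraceResolvent b z (Function.update x p 0)‖ ≤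
      (Fintype.card (Site n) : ℝ)⁻¹ * ((z.im ^ 2)⁻¹ * (2 * ((√b)⁻¹ * |x p|))) := by
  rw [normalizedTraceResolvent, normalizedTraceResolvent, ← mul_sub, norm_mul, norm_inv,
    Complex.norm_natCast]
  gcongr
  refine (norm_trace_complexResolvent_sub_le (symmetricMatrix_isHermitian b _)
    (symmetricMatrix_isHermitian b _) hz).trans ?_
  gcongr
  exact sum_abs_symmetricMatrix_sub_update_le b x p

end NormalizedTrace

/-! ### Moments of the entries and the variance bound -/

section Family

variable {Ω : Type*} [MeasurableSpace Ω] {P : Measure Ω} {n : ℕ} {b : ℝ} {ψ : ℝ → ℝ}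
  {a d : Site n → Site n → Ω → ℝ}

theorem IsPercolationFamily.ae_eq_one_or_eq_zero [IsProbabilityMeasure P]
    (h : IsPercolationFamily P ψ n b a d) {i j : Site n} (hij : i ≤ j) :
    ∀ᵐ ω ∂P, d i j ω = 1 ∨ d i j ω = 0 := by
  have hm : ∀ c : ℝ, MeasurableSet {ω | d i j ω = c} := fun c =>
    h.measurable_d i j hij (measurableSet_singleton c)
  have hdisj : Disjoint {ω | d i j ω = 1} {ω | d i j ω = 0} :=
    Set.disjoint_left.2 fun ω h1 h0 => one_ne_zero ((Eq.symm h1).trans h0)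
  have hu : P.real ({ω | d i j ω = 1} ∪ {ω | d i j ω = 0}) = 1 := by
    rw [measureReal_union hdisj (hm 0), h.prob_one i j hij, h.prob_zero i j hij]
    ring
  have : P ({ω | d i j ω = 1} ∪ {ω | d i j ω = 0}) = 1 := by
    rw [measureReal_def] at hu
    rw [← ENNReal.ofReal_toReal (measure_ne_top P _), hu, ENNReal.ofReal_one]
  exact (prob_compl_eq_zero_iff ((hm 1).union (hm 0))).2 this

theorem IsPercolationFamily.memLp_two [IsFiniteMeasure P] (h : IsPercolationFamily P ψ n b a d)
    (hM : supAbsMoment P a 7 < ∞) {i j : Site n} (hij : i ≤ j) : MemLp (a i j) 2 P := by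
  have hle : ∫⁻ ω, ‖a i j ω‖ₑ ^ 7 ∂P ≤ supAbsMoment P a 7 :=
    le_iSup_of_le i (le_iSup_of_le j (le_iSup_of_le hij le_rfl))
  have h7 : MemLp (a i j) 7 P := by
    refine ⟨(h.measurable_a i j hij).aestronglyMeasurable, ?_⟩
    rw [eLpNorm_lt_top_iff_lintegral_rpow_enorm_lt_top (by norm_num) (by norm_num)]
    have : ((7 : ℝ≥0∞).toReal) = ((7 : ℕ) : ℝ) := by simp
    simp_rw [this, ENNReal.rpow_natCast]
    exact hle.trans_lt hM
  exact h7.mono_exponent (by norm_num)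

theorem IsPercolationFamily.iIndepFun_mul (h : IsPercolationFamily P ψ n b a d) :
    iIndepFun (fun (p : UpperPair n) ω => a p.1.1 p.1.2 ω * d p.1.1 p.1.2 ω) P :=
  (iIndepFun.prodMk_of_sumElim (fun p : UpperPair n => h.measurable_a _ _ p.2)
    (fun p : UpperPair n => h.measurable_d _ _ p.2) h.indep).comp
    (fun _ (q : ℝ × ℝ) => q.1 * q.2) fun _ => measurable_fst.mul measurable_snd

theorem IsPercolationFamily.sq_mul_le [IsProbabilityMeasure P]
    (h : IsPercolationFamily P ψ n b a d) {i j : Site n} (hij : i ≤ j) :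
    ∀ᵐ ω ∂P, (a i j ω * d i j ω) ^ 2 ≤ a i j ω ^ 2 := by
  filter_upwards [h.ae_eq_one_or_eq_zero hij] with ω hω
  rcases hω with hω | hω
  · simp [hω]
  · simp [hω, sq_nonneg]

theorem IsPercolationFamily.integrable_sq_mul [IsProbabilityMeasure P]
    (h : IsPercolationFamily P ψ n b a d) {i j : Site n} (hij : i ≤ j)
    (ha : MemLp (a i j) 2 P) : Integrable (fun ω => (a i j ω * d i j ω) ^ 2) P := by
  refine ha.integrable_sq.mono'
    (((h.measurable_a i j hij).mul (h.measurable_d i j hij)).pow_const 2).aestronglyMeasurable ?_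
  filter_upwards [h.sq_mul_le hij] with ω hω
  rwa [Real.norm_of_nonneg (sq_nonneg _)]

theorem IsPercolationFamily.memLp_gTransform [IsProbabilityMeasure P]
    (h : IsPercolationFamily P ψ n b a d) {z : ℂ} (hz : z.im ≠ 0) (q : ℝ≥0∞) :
    MemLp (gTransform b a d z) q P := by
  have heq : gTransform b a d z = fun ω => normalizedTraceResolvent b z
      fun p : UpperPair n => a p.1.1 p.1.2 ω * d p.1.1 p.1.2 ω :=
    funext (gTransform_eq a d hz)
  rw [heq]
  exact .of_measurable_of_norm_le (measurable_normalizedTraceResolvent.comp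
    (measurable_pi_lambda _ fun p => (h.measurable_a _ _ p.2).mul (h.measurable_d _ _ p.2)))
    (fun _ => norm_normalizedTraceResolvent_le hz _) q

theorem IsPercolationFamily.complexVariance_gTransform_le [IsProbabilityMeasure P]
    (h : IsPercolationFamily P ψ n b a d) (hb : 0 < b) {V : ℝ}
    (ha : ∀ i j, i ≤ j → MemLp (a i j) 2 P)
    (hV : ∀ i j, i ≤ j → ∫ ω, a i j ω ^ 2 ∂P ≤ V) {z : ℂ} (hz : z.im ≠ 0) :
    complexVariance P (gTransform b a d z) ≤ 4 * V / (z.im ^ 4 * b) := by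
  set N : ℝ := (Fintype.card (Site n) : ℝ) with hN
  have hN0 : 0 < N := card_site_pos n
  set K : ℝ := N⁻¹ * ((z.im ^ 2)⁻¹ * (2 * (√b)⁻¹)) with hK
  have hKsq : ∀ t : ℝ, (N⁻¹ * ((z.im ^ 2)⁻¹ * (2 * ((√b)⁻¹ * |t|)))) ^ 2 = K ^ 2 * t ^ 2 :=
    fun t => by rw [hK, ← sq_abs t]; ring
  have hZ : ∀ p : UpperPair n, Measurable fun ω => a p.1.1 p.1.2 ω * d p.1.1 p.1.2 ω := fun p =>
    (h.measurable_a _ _ p.2).mul (h.measurable_d _ _ p.2)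
  have key := h.iIndepFun_mul.integral_norm_sub_integral_sq_le hZ 0
    (measurable_normalizedTraceResolvent (b := b) (z := z))
    (norm_normalizedTraceResolvent_le hz)
    (w := fun _ t => N⁻¹ * ((z.im ^ 2)⁻¹ * (2 * ((√b)⁻¹ * |t|))))
    (fun _ => by fun_prop)
    (fun p => by
      simp_rw [hKsq]
      exact (h.integrable_sq_mul p.2 (ha _ _ p.2)).const_mul _)
    (norm_normalizedTraceResolvent_sub_update_le hz)
  simp_rw [hKsq, integral_const_mul, ← gTransform_eq a d hz] at key
  have hle : ∀ p : UpperPair n,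
      ∫ ω, (a p.1.1 p.1.2 ω * d p.1.1 p.1.2 ω) ^ 2 ∂P ≤ V := fun p =>
    (integral_mono_ae (h.integrable_sq_mul p.2 (ha _ _ p.2)) (ha _ _ p.2).integrable_sq
      (h.sq_mul_le p.2)).trans (hV _ _ p.2)
  have hV0 : 0 ≤ V := by
    have i₀ : Site n := ⟨0, by simp⟩
    exact (integral_nonneg fun ω => sq_nonneg _).trans (hV i₀ i₀ le_rfl)
  -- The crude count `N²` already matches the factor `N⁻²` in `K ^ 2`.
  have hcard : (Fintype.card (UpperPair n) : ℝ) ≤ N ^ 2 := by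
    rw [hN, sq, ← Nat.cast_mul, ← Fintype.card_prod]
    exact_mod_cast Fintype.card_subtype_le _
  calc complexVariance P (gTransform b a d z)
      ≤ ∑ p : UpperPair n, K ^ 2 * ∫ ω, (a p.1.1 p.1.2 ω * d p.1.1 p.1.2 ω) ^ 2 ∂P := key
    _ ≤ ∑ _p : UpperPair n, K ^ 2 * V := by gcongr with p; exact hle p
    _ = Fintype.card (UpperPair n) * (K ^ 2 * V) := by simp
    _ ≤ N ^ 2 * (K ^ 2 * V) := by gcongr
    _ = 4 * V / (z.im ^ 4 * b) := by
      have hs : (√b)⁻¹ ^ 2 = b⁻¹ := by rw [inv_pow, Real.sq_sqrt hb.le]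
      rw [hK, mul_pow, mul_pow, mul_pow, hs]
      field_simp
      ring

end Family

theorem theorem5p1 (v : ℝ) (hv : 0 ≤ v) (ψ : ℝ → ℝ) (hψ : IsPercolationProfile ψ) (M : ℝ≥0) :
    ∃ (C b₀ : ℝ) (n₀ : ℕ), ∀ (n : ℕ) (b : ℝ), n₀ ≤ n → b₀ ≤ b → 0 < b → b ≤ 2 * (n : ℝ) + 1 →
      ∀ (Ω : Type*) [MeasurableSpace Ω] (P : Measure Ω) [IsProbabilityMeasure P]
        (a d : Site n → Site n → Ω → ℝ),
        IsPercolationFamily P ψ n b a d →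
        (∀ i j, i ≤ j → ∀ l : ℕ, l ≤ 2 → ∫ ω, a i j ω ^ (2 * l + 1) ∂P = 0) →
        (∀ i j, i ≤ j → ∫ ω, a i j ω ^ 2 ∂P = v ^ 2) →
        (∀ i j, i ≤ j → ∫ ω, a i j ω ^ 4 ∂P = 3 * v ^ 4) →
        (∀ i j, i ≤ j → ∫ ω, a i j ω ^ 6 ∂P = 15 * v ^ 6) →
        supAbsMoment P a 7 ≤ (M : ℝ≥0∞) →
        ∀ z : ℂ, 2 * v + 1 ≤ |z.im| →
          MemLp (gTransform b a d z) 2 P ∧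
          complexVariance P (gTransform b a d z) ≤ C / b := by
  -- The estimate holds for every `n` and every `b > 0`, so both thresholds are `0`; `|Im z| ≥ 1`
  -- absorbs the factor `|Im z|⁻⁴`.
  refine ⟨4 * v ^ 2, 0, 0, fun n b _ _ hb _ Ω _ P _ a d h _ h2 _ _ hM z hz => ?_⟩
  have h1 : 1 ≤ |z.im| := by linarith
  have hz0 : z.im ≠ 0 := abs_pos.1 (one_pos.trans_le h1)
  refine ⟨h.memLp_gTransform hz0 2, ?_⟩
  have hz4 : 1 ≤ z.im ^ 4 := by
    rw [← Even.pow_abs (by decide : Even 4)]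
    exact one_le_pow₀ h1
  refine (h.complexVariance_gTransform_le hb
    (fun i j hij => h.memLp_two (hM.trans_lt ENNReal.coe_lt_top) hij)
    (fun i j hij => (h2 i j hij).le) hz0).trans ?_
  gcongr
  exact le_mul_of_one_le_left hb.le hz4
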